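/- Conventions. A lattice polytope $\mathcal P\subset\mathbb R^d$ is the convex hull of a nonempty finite set of points of $\mathbb Z^d$. Two lattice polytopes $\mathcal P,\mathcal Q\subset\mathbb R^d$ are unimodularly equivalent if $\mathcal Q=\{xU+w : x\in\mathcal P\}$ for some integer matrix $U$ with $\det U=\pm1$ and some $w\in\mathbb Z^d$. For a $d$-dimensional lattice polytope $\mathcal P\subset\mathbb R^d$, its codegree is $\operatorname{codeg}(\mathcal P)=\min\{n\ge 1 : \operatorname{int}(n\mathcal P)\cap\mathbb Z^d\ne\emptyset\}$ and its degree is $d+1-\operatorname{codeg}(\mathcal P)$. It is reflexive if $0\in\operatorname{int}(\mathcal P)$ and $\{y\in\mathbb R^d : \langle x,y\rangle\le 1 \text{ for all } x\in\mathcal P\}$ is a lattice polytope, and Gorenstein if $r\mathcal P$ is unimodularly equivalent to a reflexive polytope for some integer $r\ge1$. It is a lattice pyramid if $d\ge 1$ and it is unimodularly equivalent to $\operatorname{conv}(\mathcal Q\times\{0\},(0,\dots,0,1))$ for some $(d-1)$-dimensional lattice polytope $\mathcal Q\subset\mathbb R^{d-1}$. For a $d$-dimensional lattice simplex $\Delta=\operatorname{conv}(v_0,\dots,v_d)\subset\mathbb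 R^d$ with ordered vertices, the associated finite abelian group is $$\Lambda_\Delta=\Big\{(x_0,\dots,x_d)\in[0,1)^{d+1} : \sum_{i=0}^d x_i(v_i,1)\in\mathbb Z^{d+1}\Big\},$$ with coordinatewise addition modulo $1$. A binary linear code $C\subset\mathbb F_2^{n}$ (a linear subspace) is even if every codeword has an even number of nonzero entries, and self-complementary if it contains the all-one vector; $\tfrac12 C=\{\tfrac12 c\in[0,1)^n : c\in C\}$, where the entries of $c$ are read as the real numbers $0$ and $1$. Theorem. Let $s\ge 1$ be an integer. (1) Let $\Delta\subset\mathbb R^{2s-1}$ be a $(2s-1)$-dimensional Gorenstein lattice simplex of degree $s$ which is not a lattice pyramid. Then there exists an even self-complementary binary linear code $C\subset\mathbb F_2^{2s}$ such that $\Lambda_\Delta=\tfrac12 C$. (2) Conversely, for every even self-complementary binary linear code $C\subset\mathbb F_2^{2s}$ there exists a $(2s-1)$-dimensional Gorenstein lattice simplex $\Delta\subset\mathbb R^{2s-1}$ of degree $s$ which is not a lattice pyramid and whose vertices can be ordered so that $\Lambda_\Delta=\tfrac12 C$. -/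

import Mathlib

open scoped Pointwise Matrix

noncomputable section

namespace LatticeSimplexCode

/-- An integer vector viewed as a point of `ℝ^d`. -/
def toReal {d : ℕ} (z : Fin d → ℤ) : Fin d → ℝ := fun i => (z i : ℝ)

/-- The lattice `ℤ^d`, as a subset of `ℝ^d`. -/
def integerLattice (d : ℕ) : Set (Fin d → ℝ) := Set.range toReal

/-- A lattice polytope: the convex hull of a nonempty finite set of lattice points. -/
def IsLatticePolytope {d : ℕ} (P : Set (Fin d → ℝ)) : Prop :=
  ∃ V : Finset (Fin d → ℤ), V.Nonempty ∧ P = convexHull ℝ (toReal '' (V : Set (Fin d → ℤ)))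

/-- `P ⊆ ℝ^d` has dimension `d`. -/
def IsFullDimensional {d : ℕ} (P : Set (Fin d → ℝ)) : Prop := affineSpan ℝ P = ⊤

/-- Unimodular equivalence: `Q = P U + w` with `U` an integer matrix of determinant `±1` and
`w` a lattice point. -/
def UnimodularlyEquivalent {d : ℕ} (P Q : Set (Fin d → ℝ)) : Prop :=
  ∃ (U : Matrix (Fin d) (Fin d) ℤ) (w : Fin d → ℤ), IsUnit U.det ∧
    Q = (fun x : Fin d → ℝ => x ᵥ* U.map (Int.cast : ℤ → ℝ) + toReal w) '' P

/-- `Pyr(P) = conv (P × {0}, (0, …, 0, 1)) ⊆ ℝ^(d+1)`. -/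
def pyramid {d : ℕ} (P : Set (Fin d → ℝ)) : Set (Fin (d + 1) → ℝ) :=
  convexHull ℝ
    (((fun x : Fin d → ℝ => (Fin.snoc x 0 : Fin (d + 1) → ℝ)) '' P) ∪
      {(Fin.snoc (0 : Fin d → ℝ) 1 : Fin (d + 1) → ℝ)})

/-- `P` is, up to unimodular equivalence, the pyramid over a full-dimensional lattice polytope in
one dimension less. An iterated pyramid is in particular a pyramid in this sense, its base being
allowed to be a pyramid itself. -/
def IsLatticePyramid : {d : ℕ} → Set (Fin d → ℝ) → Prop
  | 0, _ => False
  | k + 1, P => ∃ Q : Set (Fin k → ℝ), IsLatticePolytope Q ∧ IsFullDimensional Q ∧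
      UnimodularlyEquivalent P (pyramid Q)

/-- The least `n > 0` such that the interior of `n P` contains a lattice point. Such an `n` exists
for every full-dimensional lattice polytope. -/
def codegree {d : ℕ} (P : Set (Fin d → ℝ)) : ℕ :=
  sInf {n : ℕ | 0 < n ∧ (interior ((n : ℝ) • P) ∩ integerLattice d).Nonempty}

/-- `deg P = d + 1 - codeg P`, for a lattice polytope `P ⊆ ℝ^d` of dimension `d`. -/
def degree {d : ℕ} (P : Set (Fin d → ℝ)) : ℤ := (d : ℤ) + 1 - (codegree P : ℤ)

/-- The dual `{y | ⟨x, y⟩ ≤ 1 for all x ∈ P}`. -/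
def dualPolytope {d : ℕ} (P : Set (Fin d → ℝ)) : Set (Fin d → ℝ) :=
  {y | ∀ x ∈ P, x ⬝ᵥ y ≤ 1}

/-- Reflexive polytopes: lattice polytopes with the origin in the interior whose dual is again a
lattice polytope. -/
def IsReflexive {d : ℕ} (P : Set (Fin d → ℝ)) : Prop :=
  IsLatticePolytope P ∧ (0 : Fin d → ℝ) ∈ interior P ∧ IsLatticePolytope (dualPolytope P)

/-- `P` is Gorenstein of index `r`. -/
def IsGorensteinOfIndex {d : ℕ} (P : Set (Fin d → ℝ)) (r : ℕ) : Prop :=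
  IsLatticePolytope P ∧ 0 < r ∧
    ∃ Q : Set (Fin d → ℝ), IsReflexive Q ∧ UnimodularlyEquivalent ((r : ℝ) • P) Q

/-- `P` is Gorenstein (of some index). -/
def IsGorenstein {d : ℕ} (P : Set (Fin d → ℝ)) : Prop := ∃ r : ℕ, IsGorensteinOfIndex P r

/-- The lattice points `v 0, …, v (n - 1)` are the vertices of an `(n - 1)`-dimensional lattice
simplex. -/
def IsSimplexVertices {n d : ℕ} (v : Fin n → Fin d → ℤ) : Prop :=
  AffineIndependent ℝ (fun i => toReal (v i))

/-- The lattice simplex `conv (v 0, …, v (n - 1))`. -/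
def simplex {n d : ℕ} (v : Fin n → Fin d → ℤ) : Set (Fin d → ℝ) :=
  convexHull ℝ (Set.range fun i => toReal (v i))

/-- The finite abelian group `Λ` of the simplex with vertices `v`, as a subset of `[0,1)^n`: the
points `x` for which `∑ x_i (v_i, 1)` is an integer vector. Its operation is coordinatewise
addition modulo `1`, so it is determined by its underlying set. -/
def associatedGroup {n d : ℕ} (v : Fin n → Fin d → ℤ) : Set (Fin n → ℝ) :=
  {x | (∀ i, x i ∈ Set.Ico (0 : ℝ) 1) ∧
    (∑ i, x i • toReal (v i)) ∈ integerLattice d ∧ ∃ m : ℤ, ∑ i, x i = (m : ℝ)}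

/-- A binary linear code of length `n`. -/
abbrev BinaryCode (n : ℕ) := Submodule (ZMod 2) (Fin n → ZMod 2)

/-- Every codeword has even Hamming weight. -/
def IsEvenCode {n : ℕ} (C : BinaryCode n) : Prop := ∀ c ∈ C, Even (hammingNorm c)

/-- The code contains the all-one vector. -/
def IsSelfComplementary {n : ℕ} (C : BinaryCode n) : Prop := (fun _ => 1) ∈ C

/-- The set `{½ c | c ∈ C} ⊆ [0,1)^n`, codewords being read as vectors with entries `0, 1 ∈ ℝ`. -/
def halfCode {n : ℕ} (C : BinaryCode n) : Set (Fin n → ℝ) :=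
  {x | ∃ c ∈ C, x = fun i => (1 / 2 : ℝ) * ((c i).val : ℝ)}

end LatticeSimplexCode

end

open LatticeSimplexCode

open scoped Pointwise Matrix

/-! A simplex is Gorenstein of index `r` exactly through a weight `α` (`IsGorensteinWeight`): the
barycentric coordinates, of sum `r`, of an interior lattice point of the `r`-th dilate, such that
the `j`-th barycentric coordinate divided by `α j` is an integral affine function. Every lattice
point of the cone then has coordinates in `α j ℤ`, so the codegree is `r`, and degree `s` in
dimension `2s - 1` forces `r = s`.

Each `1 / α j` is a positive integer. If it were `1`, an integral affine function would be `1` at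
one vertex and `0` at the others, and the simplex would be a lattice pyramid. Hence `α j ≤ 1/2`;
since `2s` such weights sum to `s`, all equal `1/2` (`IsGorensteinWeight.eq_half`). So the group has
only half-integral coordinates and is half a code: even because coordinate sums are integers,
self-complementary because `α` itself lies in the group.

Conversely, `exists_simplex_of_code` takes the zero-sum integer vectors reducing into `C` as the
lattice and the points `2 e_i - 2 e_0` as vertices. The constant weight `1/2` is then a certificate,
from which all required properties follow. -/

namespace LatticeSimplexCode

/-! ### Integer vectors as real vectors -/

section Cast

variable {d : ℕ}

theorem toReal_add (x y : Fin d → ℤ) : toReal (x + y) = toReal x + toReal y := by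
  ext i; simp [toReal]

theorem toReal_neg (x : Fin d → ℤ) : toReal (-x) = -toReal x := by
  ext i; simp [toReal]

theorem toReal_smul (a : ℤ) (x : Fin d → ℤ) : toReal (a • x) = (a : ℝ) • toReal x := by
  ext i; simp [toReal]

theorem toReal_injective : Function.Injective (toReal : (Fin d → ℤ) → Fin d → ℝ) := by
  intro x y h
  ext i
  exact Int.cast_injective (congrFun h i)

theorem toReal_dotProduct (x y : Fin d → ℤ) : toReal x ⬝ᵥ toReal y = ((x ⬝ᵥ y : ℤ) : ℝ) := by
  simp [toReal, dotProduct]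

theorem toReal_vecMul (x : Fin d → ℤ) (U : Matrix (Fin d) (Fin d) ℤ) :
    toReal (x ᵥ* U) = toReal x ᵥ* U.map (Int.cast : ℤ → ℝ) := by
  ext i; simp [toReal, Matrix.vecMul, dotProduct]

theorem toReal_mulVec (x : Fin d → ℤ) (U : Matrix (Fin d) (Fin d) ℤ) :
    toReal (U *ᵥ x) = U.map (Int.cast : ℤ → ℝ) *ᵥ toReal x := by
  ext i; simp [toReal, Matrix.mulVec, dotProduct]

end Cast

/-! ### Barycentric coordinates and unimodular images of simplices -/

section Simplex

variable {n d : ℕ} {v : Fin n → Fin d → ℤ}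

theorem mem_simplex_iff {x : Fin d → ℝ} :
    x ∈ simplex v ↔ ∃ t : Fin n → ℝ, (∀ i, 0 ≤ t i) ∧ ∑ i, t i = 1 ∧
      ∑ i, t i • toReal (v i) = x := by
  unfold simplex
  rw [convexHull_range_eq_exists_affineCombination]
  constructor
  · rintro ⟨s, w, hw0, hw1, rfl⟩
    refine ⟨fun i => if i ∈ s then w i else 0, fun i => ?_, ?_, ?_⟩
    · dsimp only; split_ifs with h
      exacts [hw0 i h, le_rfl]
    · simpa [Finset.sum_ite_mem] using hw1
    · rw [s.affineCombination_eq_linear_combination _ _ hw1]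
      simp [ite_smul, Finset.sum_ite_mem]
  · rintro ⟨t, h0, h1, rfl⟩
    exact ⟨Finset.univ, t, fun i _ => h0 i, h1,
      Finset.affineCombination_eq_linear_combination _ _ _ h1⟩

theorem isLatticePolytope_simplex [NeZero n] (v : Fin n → Fin d → ℤ) :
    IsLatticePolytope (simplex v) := by
  classical
  refine ⟨Finset.univ.image v, by simp, ?_⟩
  unfold simplex
  congr 1
  ext x
  simp

theorem IsSimplexVertices.affineSpan_eq_top (hv : IsSimplexVertices v) (hn : n = d + 1) :
    affineSpan ℝ (Set.range fun i => toReal (v i)) = ⊤ := by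
  rw [hv.affineSpan_eq_top_iff_card_eq_finrank_add_one]
  simp [hn]

theorem IsSimplexVertices.exists_affineBasis (hv : IsSimplexVertices v) (hn : n = d + 1) :
    ∃ b : AffineBasis (Fin n) ℝ (Fin d → ℝ), ∀ i, b i = toReal (v i) :=
  ⟨⟨fun i => toReal (v i), hv, hv.affineSpan_eq_top hn⟩, fun _ => rfl⟩

/-- Interior points of a dilated simplex have positive barycentric coordinates. -/
theorem IsSimplexVertices.mem_interior_smul_iff (hv : IsSimplexVertices v) (hn : n = d + 1)
    {r : ℝ} (hr : 0 < r) {x : Fin d → ℝ} :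
    x ∈ interior (r • simplex v) ↔ ∃ t : Fin n → ℝ, (∀ i, 0 < t i) ∧ ∑ i, t i = r ∧
      ∑ i, t i • toReal (v i) = x := by
  obtain ⟨b, hb⟩ := hv.exists_affineBasis hn
  have hs : simplex v = convexHull ℝ (Set.range b) := by
    unfold simplex; congr 2; ext i : 1; exact (hb i).symm
  rw [hs, interior_smul₀ hr.ne', b.interior_convexHull, Set.mem_smul_set]
  constructor
  · rintro ⟨y, hy, rfl⟩
    refine ⟨fun i => r * b.coord i y, fun i => mul_pos hr (hy i), ?_, ?_⟩
    · rw [← Finset.mul_sum, b.sum_coord_apply_eq_one, mul_one]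
    · conv_rhs => rw [← b.linear_combination_coord_eq_self y, Finset.smul_sum]
      exact Finset.sum_congr rfl fun i _ => by rw [hb, mul_smul]
  · rintro ⟨t, ht, hsum, rfl⟩
    have h1 : ∑ i, r⁻¹ * t i = 1 := by
      rw [← Finset.mul_sum, hsum, inv_mul_cancel₀ hr.ne']
    refine ⟨∑ i, (r⁻¹ * t i) • b i, fun i => ?_, ?_⟩
    · rw [← Finset.affineCombination_eq_linear_combination _ _ _ h1,
        b.coord_apply_combination_of_mem (Finset.mem_univ i) h1]
      exact mul_pos (inv_pos.2 hr) (ht i)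
    · rw [Finset.smul_sum]
      refine Finset.sum_congr rfl fun i _ => ?_
      rw [smul_smul, mul_inv_cancel_left₀ hr.ne', hb]

theorem IsSimplexVertices.mem_interior_iff (hv : IsSimplexVertices v) (hn : n = d + 1)
    {x : Fin d → ℝ} :
    x ∈ interior (simplex v) ↔ ∃ t : Fin n → ℝ, (∀ i, 0 < t i) ∧ ∑ i, t i = 1 ∧
      ∑ i, t i • toReal (v i) = x := by
  simpa using hv.mem_interior_smul_iff hn one_pos (x := x)

/-- The dilation by `r` followed by the unimodular map `x ↦ x U + w`, as an affine map. -/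
noncomputable def dilatedUnimodularMap (r : ℝ) (U : Matrix (Fin d) (Fin d) ℤ) (w : Fin d → ℤ) :
    (Fin d → ℝ) →ᵃ[ℝ] (Fin d → ℝ) :=
  (r • Matrix.vecMulLinear (U.map (Int.cast : ℤ → ℝ))).toAffineMap +
    AffineMap.const ℝ (Fin d → ℝ) (toReal w)

theorem dilatedUnimodularMap_apply (r : ℝ) (U : Matrix (Fin d) (Fin d) ℤ) (w : Fin d → ℤ)
    (x : Fin d → ℝ) :
    dilatedUnimodularMap r U w x = r • (x ᵥ* U.map (Int.cast : ℤ → ℝ)) + toReal w := rfl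

theorem dilatedUnimodularMap_toReal (r : ℕ) (U : Matrix (Fin d) (Fin d) ℤ) (w x : Fin d → ℤ) :
    dilatedUnimodularMap r U w (toReal x) = toReal ((r : ℤ) • (x ᵥ* U) + w) := by
  rw [dilatedUnimodularMap_apply, toReal_add, toReal_smul, toReal_vecMul, Int.cast_natCast]

theorem vecMul_map_intCast_injective {U : Matrix (Fin d) (Fin d) ℤ} (hU : IsUnit U.det) :
    Function.Injective fun x : Fin d → ℝ => x ᵥ* U.map (Int.cast : ℤ → ℝ) := by
  rw [Matrix.vecMul_injective_iff_isUnit, Matrix.isUnit_iff_isUnit_det]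
  have := hU.map (Int.castRingHom ℝ)
  rwa [RingHom.map_det] at this

theorem dilatedUnimodularMap_injective {r : ℝ} (hr : r ≠ 0) {U : Matrix (Fin d) (Fin d) ℤ}
    (hU : IsUnit U.det) (w : Fin d → ℤ) : Function.Injective (dilatedUnimodularMap r U w) := by
  intro x y h
  simp only [dilatedUnimodularMap_apply, add_left_inj] at h
  exact vecMul_map_intCast_injective hU (smul_right_injective _ hr h)

theorem IsSimplexVertices.unimodular_image (hv : IsSimplexVertices v) {r : ℕ} (hr : 0 < r)
    {U : Matrix (Fin d) (Fin d) ℤ} (hU : IsUnit U.det) (w : Fin d → ℤ) :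
    IsSimplexVertices (fun i => (r : ℤ) • (v i ᵥ* U) + w) := by
  have := AffineIndependent.map' hv (dilatedUnimodularMap r U w)
    (dilatedUnimodularMap_injective (by exact_mod_cast hr.ne') hU w)
  refine Eq.mp ?_ this
  unfold IsSimplexVertices
  congr 1
  ext i : 1
  simp only [Function.comp, dilatedUnimodularMap_toReal]

theorem unimodular_image_smul_simplex (v : Fin n → Fin d → ℤ) (r : ℕ)
    (U : Matrix (Fin d) (Fin d) ℤ) (w : Fin d → ℤ) :
    (fun x : Fin d → ℝ => x ᵥ* U.map (Int.cast : ℤ → ℝ) + toReal w) '' ((r : ℝ) • simplex v) =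
      simplex (fun i => (r : ℤ) • (v i ᵥ* U) + w) := by
  have h : (fun x : Fin d → ℝ => x ᵥ* U.map (Int.cast : ℤ → ℝ) + toReal w) ''
      ((r : ℝ) • simplex v) = dilatedUnimodularMap r U w '' simplex v := by
    rw [← Set.image_smul, Set.image_image]
    refine Set.image_congr fun x _ => ?_
    rw [dilatedUnimodularMap_apply, Matrix.smul_vecMul]
  rw [h]
  unfold simplex
  rw [AffineMap.image_convexHull, ← Set.range_comp]
  congr 2
  ext i : 1
  simp only [Function.comp, dilatedUnimodularMap_toReal]

end Simplex

/-! ### Gorenstein simplices and their weights -/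

section Gorenstein

variable {n d : ℕ} {v : Fin n → Fin d → ℤ}

theorem IsSimplexVertices.dotProduct_ext (hv : IsSimplexVertices v) (hn : n = d + 1)
    {y z : Fin d → ℝ} (h : ∀ i, toReal (v i) ⬝ᵥ y = toReal (v i) ⬝ᵥ z) : y = z := by
  obtain ⟨b, hb⟩ := hv.exists_affineBasis hn
  refine dotProduct_eq _ _ fun x => ?_
  rw [dotProduct_comm y, dotProduct_comm z, ← b.linear_combination_coord_eq_self x,
    sum_dotProduct, sum_dotProduct]
  exact Finset.sum_congr rfl fun i _ => by rw [smul_dotProduct, smul_dotProduct, hb, h]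

theorem linearMap_apply_eq_dotProduct (f : (Fin d → ℝ) →ₗ[ℝ] ℝ) (x : Fin d → ℝ) :
    f x = x ⬝ᵥ fun k => f (Pi.single k 1) := by
  rw [f.pi_apply_eq_sum_univ x]
  simp only [dotProduct, smul_eq_mul]
  refine Finset.sum_congr rfl fun k _ => ?_
  congr 2
  ext l
  simp [Pi.single_apply, eq_comm]

/-- The `j`-th barycentric coordinate is `t j` at the origin, so dividing its linear part by `-t j`
gives the functional that is `1` on the facet opposite vertex `j`. -/
theorem IsSimplexVertices.exists_facet_normal (hv : IsSimplexVertices v) (hn : n = d + 1)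
    {t : Fin n → ℝ} (ht : ∀ i, 0 < t i) (hsum : ∑ i, t i = 1)
    (hzero : ∑ i, t i • toReal (v i) = 0) (j : Fin n) :
    ∃ y : Fin d → ℝ, ∀ i, toReal (v i) ⬝ᵥ y = 1 - if i = j then 1 / t j else 0 := by
  obtain ⟨b, hb⟩ := hv.exists_affineBasis hn
  have h0 : b.coord j 0 = t j := by
    rw [← hzero]
    simp only [← hb]
    rw [← Finset.affineCombination_eq_linear_combination _ _ _ hsum,
      b.coord_apply_combination_of_mem (Finset.mem_univ j) hsum]
  refine ⟨fun k => (-(1 / t j) • (b.coord j).linear) (Pi.single k 1), fun i => ?_⟩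
  rw [← linearMap_apply_eq_dotProduct]
  have h1 : b.coord j (toReal (v i)) = (b.coord j).linear (toReal (v i)) + t j := by
    rw [← h0]
    simpa using (b.coord j).map_vadd 0 (toReal (v i))
  have h2 : (b.coord j).linear (toReal (v i)) = (if j = i then 1 else 0) - t j := by
    rw [← b.coord_apply j i, hb, h1]; ring
  have := (ht j).ne'
  simp only [LinearMap.smul_apply, h2, smul_eq_mul, eq_comm (a := j)]
  split_ifs <;> field_simp <;> ring

/-- The normal makes all inequalities with `i ≠ j` tight, hence so do the endpoints of any segment
of the dual through it; the pairing with vertex `j` is then determined by the linear relation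
`hzero`. -/
theorem IsSimplexVertices.facet_normal_mem_extremePoints (hv : IsSimplexVertices v)
    (hn : n = d + 1) {t : Fin n → ℝ} (ht : ∀ i, 0 < t i)
    (hzero : ∑ i, t i • toReal (v i) = 0) {j : Fin n} {y : Fin d → ℝ}
    (hy : ∀ i, toReal (v i) ⬝ᵥ y = 1 - if i = j then 1 / t j else 0) :
    y ∈ (dualPolytope (simplex v)).extremePoints ℝ := by
  have hsub : ∀ i, toReal (v i) ∈ simplex v := fun i => subset_convexHull ℝ _ ⟨i, rfl⟩
  have hy1 : ∀ i, toReal (v i) ⬝ᵥ y ≤ 1 := fun i => by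
    rw [hy]
    have := (one_div_pos.2 (ht j)).le
    split_ifs <;> linarith
  rw [mem_extremePoints]
  have key : ∀ p ∈ dualPolytope (simplex v), ∀ q ∈ dualPolytope (simplex v),
      y ∈ openSegment ℝ p q → p = y := by
    rintro p hp q hq ⟨a, b, ha, hb, hab, rfl⟩
    have hne : ∀ i, i ≠ j → toReal (v i) ⬝ᵥ p = toReal (v i) ⬝ᵥ (a • p + b • q) := by
      intro i hij
      have h1 := hy i
      have hpi := hp _ (hsub i)
      have hqi := hq _ (hsub i)
      rw [h1, if_neg hij]
      rw [if_neg hij, dotProduct_add, dotProduct_smul, dotProduct_smul] at h1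
      simp only [smul_eq_mul] at h1
      nlinarith
    refine hv.dotProduct_ext hn fun i => ?_
    by_cases hij : i = j
    · have hexp : ∀ z : Fin d → ℝ, t j * (toReal (v j) ⬝ᵥ z) =
          -∑ i ∈ Finset.univ.erase j, t i * (toReal (v i) ⬝ᵥ z) := fun z => by
        rw [eq_neg_iff_add_eq_zero,
          Finset.add_sum_erase _ (fun i => t i * (toReal (v i) ⬝ᵥ z)) (Finset.mem_univ j)]
        have := congrArg (· ⬝ᵥ z) hzero
        simpa [sum_dotProduct] using this
      subst hij
      apply mul_left_cancel₀ (ht i).ne'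
      rw [hexp, hexp]
      congr 1
      exact Finset.sum_congr rfl fun k hk => by rw [hne k (Finset.ne_of_mem_erase hk)]
    · exact hne i hij
  refine ⟨fun x hx => ?_, fun p hp q hq h =>
    ⟨key p hp q hq h, key q hq p hp (by rwa [openSegment_symm])⟩⟩
  obtain ⟨s, hs0, hs1, rfl⟩ := mem_simplex_iff.1 hx
  rw [sum_dotProduct, ← hs1]
  exact Finset.sum_le_sum fun i _ => by
    rw [smul_dotProduct, smul_eq_mul]
    exact mul_le_of_le_one_right (hs0 i) (hy1 i)

/-- The origin of a reflexive simplex is a positive combination of the vertices whose weights are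
the reciprocals of integers, and the facets are at lattice distance one. -/
theorem IsReflexive.exists_weights (h : IsReflexive (simplex v)) (hv : IsSimplexVertices v)
    (hn : n = d + 1) :
    ∃ t : Fin n → ℝ, (∀ i, 0 < t i) ∧ ∑ i, t i = 1 ∧ ∑ i, t i • toReal (v i) = 0 ∧
      ∀ j, ∃ y : Fin d → ℤ, ∀ i,
        toReal (v i) ⬝ᵥ toReal y = 1 - if i = j then 1 / t j else 0 := by
  obtain ⟨-, h0, V, -, hV⟩ := h
  obtain ⟨t, ht, hsum, hzero⟩ := (hv.mem_interior_iff hn).1 h0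
  refine ⟨t, ht, hsum, hzero, fun j => ?_⟩
  obtain ⟨y, hy⟩ := hv.exists_facet_normal hn ht hsum hzero j
  have hext := hv.facet_normal_mem_extremePoints hn ht hzero hy
  rw [hV] at hext
  -- Extreme points of the hull of lattice points are among those points, so the normal is integral.
  obtain ⟨z, -, rfl⟩ := extremePoints_convexHull_subset hext
  exact ⟨z, hy⟩

/-- Arithmetic certificate for a lattice simplex being Gorenstein: `∑ α_i v_i` is a lattice point
of the interior of the `r`-th dilate, and each barycentric coordinate on the cone over the simplex
takes values in `α_j ℤ` on lattice points. -/
structure IsGorensteinWeight (v : Fin n → Fin d → ℤ) (r : ℕ) (α : Fin n → ℝ) : Prop where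
  pos : ∀ i, 0 < α i
  sum_eq : ∑ i, α i = r
  lattice : ∃ w : Fin d → ℤ, ∑ i, α i • toReal (v i) = toReal w
  integral : ∀ j, ∃ (y : Fin d → ℤ) (c : ℤ), ∀ i,
    toReal (v i) ⬝ᵥ toReal y + c = if i = j then 1 / α j else 0

theorem IsGorensteinOfIndex.exists_weight {r : ℕ} (h : IsGorensteinOfIndex (simplex v) r)
    (hv : IsSimplexVertices v) (hn : n = d + 1) (hd : 0 < d) :
    ∃ α, IsGorensteinWeight v r α := by
  obtain ⟨-, hr, Q, hQ, U, w, hU, rfl⟩ := h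
  have hr' : (r : ℝ) ≠ 0 := by exact_mod_cast hr.ne'
  rw [unimodular_image_smul_simplex] at hQ
  obtain ⟨t, ht, hsum, hzero, hy⟩ := hQ.exists_weights (hv.unimodular_image hr hU w) hn
  refine ⟨fun i => r * t i, ⟨fun i => mul_pos (by exact_mod_cast hr) (ht i), ?_, ?_, ?_⟩⟩
  · rw [← Finset.mul_sum, hsum, mul_one]
  -- The lattice point is the preimage of the origin under `x ↦ x U + w`.
  · refine ⟨-(w ᵥ* U⁻¹), vecMul_map_intCast_injective hU ?_⟩
    dsimp only
    rw [← toReal_vecMul, Matrix.neg_vecMul, Matrix.vecMul_vecMul, Matrix.nonsing_inv_mul _ hU,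
      Matrix.vecMul_one, toReal_neg, Matrix.sum_vecMul]
    rw [← sub_eq_zero, sub_neg_eq_add, ← hzero]
    simp only [toReal_add, toReal_smul, smul_add, Finset.sum_add_distrib, ← Finset.sum_smul, hsum,
      one_smul, toReal_vecMul, Matrix.smul_vecMul, mul_smul]
    congr 1
    exact Finset.sum_congr rfl fun i _ => by rw [smul_comm]; simp
  · intro j
    obtain ⟨y, hy⟩ := hy j
    -- The constant term should be `(1 - ⟨w, y⟩) / r`. Evaluating at another vertex `l` shows that
    -- it equals `⟨v l U, y⟩`, an integer; this is where `0 < d` enters.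
    obtain ⟨l, hl⟩ : ∃ l, l ≠ j := by
      have : Nontrivial (Fin n) := Fin.nontrivial_iff_two_le.2 (by omega)
      exact exists_ne j
    refine ⟨-(U *ᵥ y), (v l ᵥ* U) ⬝ᵥ y, fun i => ?_⟩
    have h1 := hy i
    have h2 := hy l
    rw [if_neg hl] at h2
    simp only [toReal_add, toReal_smul, add_dotProduct, smul_dotProduct, smul_eq_mul] at h1 h2
    have h3 : toReal (v i) ⬝ᵥ toReal (-(U *ᵥ y)) = -(toReal (v i ᵥ* U) ⬝ᵥ toReal y) := by
      rw [toReal_neg, dotProduct_neg, toReal_mulVec, toReal_vecMul, Matrix.dotProduct_mulVec]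
    rw [h3, ← toReal_dotProduct]
    apply mul_left_cancel₀ hr'
    have := (ht j).ne'
    push_cast at h1 h2
    split_ifs at h1 ⊢
    · field_simp at h1 h2 ⊢
      linear_combination (t j) * h2 - h1
    · linear_combination h2 - h1

theorem IsGorensteinWeight.isSimplexVertices {r : ℕ} {α : Fin n → ℝ}
    (h : IsGorensteinWeight v r α) : IsSimplexVertices v := by
  unfold IsSimplexVertices
  rw [affineIndependent_iff_of_fintype]
  intro t ht h0 j
  rw [Finset.weightedVSub_eq_linear_combination _ ht] at h0
  obtain ⟨y, c, hy⟩ := h.integral j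
  have h1 : ∑ i, t i * (toReal (v i) ⬝ᵥ toReal y + c) = 0 := by
    simp only [mul_add, Finset.sum_add_distrib, ← Finset.sum_mul, ht]
    have := congrArg (· ⬝ᵥ toReal y) h0
    simpa [sum_dotProduct] using this
  simp only [hy] at h1
  simpa [(h.pos j).ne'] using h1

theorem sum_mul_affine_eq_intCast {t : Fin n → ℝ} {p : Fin d → ℤ} {m : ℤ}
    (hp : ∑ i, t i • toReal (v i) = toReal p) (hm : ∑ i, t i = m) (y : Fin d → ℤ) (c : ℤ) :
    ∑ i, t i * (toReal (v i) ⬝ᵥ toReal y + c) = ((p ⬝ᵥ y + m * c : ℤ) : ℝ) := by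
  push_cast
  rw [← toReal_dotProduct, ← hp, ← hm, sum_dotProduct, Finset.sum_mul, ← Finset.sum_add_distrib]
  exact Finset.sum_congr rfl fun i _ => by rw [smul_dotProduct, smul_eq_mul, mul_add]

/-- The quotient `t j / α j` is the value of an integral affine function at the lattice point `p` at
height `m`. -/
theorem IsGorensteinWeight.exists_int {r : ℕ} {α : Fin n → ℝ} (h : IsGorensteinWeight v r α)
    {t : Fin n → ℝ} {p : Fin d → ℤ} {m : ℤ} (hp : ∑ i, t i • toReal (v i) = toReal p)
    (hm : ∑ i, t i = m) (j : Fin n) : ∃ a : ℤ, t j = a * α j := by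
  obtain ⟨y, c, hy⟩ := h.integral j
  refine ⟨p ⬝ᵥ y + m * c, ?_⟩
  rw [← sum_mul_affine_eq_intCast hp hm y c]
  simp [hy, (h.pos j).ne']

theorem IsGorensteinWeight.codegree_eq {r : ℕ} {α : Fin n → ℝ} (h : IsGorensteinWeight v r α)
    (hn : n = d + 1) : codegree (simplex v) = r := by
  have hv := h.isSimplexVertices
  have : Nonempty (Fin n) := ⟨⟨0, by omega⟩⟩
  have hr : 0 < r := by
    have : (0 : ℝ) < r := h.sum_eq ▸ Finset.sum_pos (fun i _ => h.pos i) Finset.univ_nonempty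
    exact_mod_cast this
  obtain ⟨w, hw⟩ := h.lattice
  refine le_antisymm (Nat.sInf_le ⟨hr, toReal w, ?_, w, rfl⟩)
    (le_csInf ⟨r, hr, toReal w, ?_, w, rfl⟩ ?_)
  -- The same interior point bounds the infimum from above and shows that the set is nonempty.
  iterate 2
    exact (hv.mem_interior_smul_iff hn (by exact_mod_cast hr)).2 ⟨α, h.pos, h.sum_eq, hw⟩
  rintro k ⟨hk, _, hx, p, rfl⟩
  obtain ⟨t, ht, hsum, hp⟩ := (hv.mem_interior_smul_iff hn (by exact_mod_cast hk)).1 hx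
  -- A positive integer multiple of `α j` is at least `α j`.
  have hle : ∀ j, α j ≤ t j := fun j => by
    obtain ⟨a, ha⟩ := h.exists_int hp (m := k) (by exact_mod_cast hsum) j
    have hpos := h.pos j
    have ha0 : (0 : ℝ) < a := by
      have := ht j
      rw [ha] at this
      exact pos_of_mul_pos_left this hpos.le
    have ha1 : (1 : ℝ) ≤ a := by
      have : 0 < a := by exact_mod_cast ha0
      exact_mod_cast this
    rw [ha]
    nlinarith
  have : (r : ℝ) ≤ k := by
    rw [← h.sum_eq, ← hsum]
    exact Finset.sum_le_sum fun j _ => hle j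
  exact_mod_cast this

/-- Translating the interior lattice point `w` of the `r`-th dilate to the origin puts every facet
at lattice distance one; the dual is then the simplex on the integral normals `-y j`. -/
theorem IsGorensteinWeight.isGorenstein {r : ℕ} {α : Fin n → ℝ} (h : IsGorensteinWeight v r α)
    (hn : n = d + 1) : IsGorenstein (simplex v) := by
  have hv := h.isSimplexVertices
  have : NeZero n := ⟨by omega⟩
  have hr' : (0 : ℝ) < r := h.sum_eq ▸ Finset.sum_pos (fun i _ => h.pos i) Finset.univ_nonempty
  have hr : 0 < r := by exact_mod_cast hr'
  obtain ⟨w, hw⟩ := h.lattice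
  choose y c hy using h.integral
  have hdet : IsUnit (1 : Matrix (Fin d) (Fin d) ℤ).det := by simp
  set q : Fin n → Fin d → ℤ := fun i => (r : ℤ) • (v i ᵥ* 1) + -w with hq
  have hqv : IsSimplexVertices q := hv.unimodular_image hr hdet (-w)
  have hqr : ∀ i, toReal (q i) = (r : ℝ) • toReal (v i) - toReal w := fun i => by
    simp only [hq, Matrix.vecMul_one, toReal_add, toReal_smul, toReal_neg, sub_eq_add_neg,
      Int.cast_natCast]
  have hα : ∑ i, α i • toReal (q i) = 0 := by
    simp only [hqr, smul_sub, Finset.sum_sub_distrib, ← Finset.sum_smul, h.sum_eq]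
    simp only [smul_comm (α _) (r : ℝ), ← Finset.smul_sum, hw, sub_self]
  have hwy : ∀ j, toReal w ⬝ᵥ toReal (y j) + r * c j = 1 := fun j => by
    have h1 : ∑ i, α i * (toReal (v i) ⬝ᵥ toReal (y j) + c j) = 1 := by
      simp [hy, (h.pos j).ne']
    rw [← h1, ← hw, ← h.sum_eq, sum_dotProduct, Finset.sum_mul, ← Finset.sum_add_distrib]
    exact Finset.sum_congr rfl fun i _ => by rw [smul_dotProduct, smul_eq_mul, mul_add]
  have hqy : ∀ i j, toReal (q i) ⬝ᵥ toReal (-y j) = 1 - if i = j then r / α j else 0 := by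
    intro i j
    have h1 := hy j i
    have h2 := hwy j
    rw [toReal_neg, dotProduct_neg, hqr, sub_dotProduct, smul_dotProduct, smul_eq_mul]
    split_ifs at h1 ⊢
    · linear_combination h2 - r * h1
    · linear_combination h2 - r * h1
  refine ⟨r, isLatticePolytope_simplex v, hr, simplex q, ⟨isLatticePolytope_simplex q, ?_, ?_⟩,
    1, -w, hdet, (unimodular_image_smul_simplex v r 1 (-w)).symm⟩
  · refine (hqv.mem_interior_iff hn).2 ⟨fun i => (r : ℝ)⁻¹ * α i,
      fun i => mul_pos (inv_pos.2 hr') (h.pos i), ?_, ?_⟩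
    · rw [← Finset.mul_sum, h.sum_eq, inv_mul_cancel₀ hr'.ne']
    · simp only [mul_smul, ← Finset.smul_sum, hα, smul_zero]
  · have hdual : dualPolytope (simplex q) = simplex (fun j => -y j) := by
      ext x
      rw [mem_simplex_iff]
      constructor
      · intro hx
        have hx' : ∀ i, toReal (q i) ⬝ᵥ x ≤ 1 := fun i =>
          hx _ (subset_convexHull ℝ _ ⟨i, rfl⟩)
        have hsum : ∑ i, α i * (1 - toReal (q i) ⬝ᵥ x) / r = 1 := by
          have := congrArg (· ⬝ᵥ x) hα
          simp only [sum_dotProduct, smul_dotProduct, smul_eq_mul, zero_dotProduct] at this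
          rw [← Finset.sum_div]
          simp only [mul_sub, mul_one, Finset.sum_sub_distrib, this, h.sum_eq, sub_zero]
          exact div_self hr'.ne'
        -- The barycentric coordinates in the dual simplex are the slacks of the defining
        -- inequalities, scaled as `hqy` dictates.
        refine ⟨fun i => α i * (1 - toReal (q i) ⬝ᵥ x) / r, fun i => ?_, hsum, ?_⟩
        · exact div_nonneg (mul_nonneg (h.pos i).le (sub_nonneg.2 (hx' i))) hr'.le
        · refine hqv.dotProduct_ext hn fun i => ?_
          rw [dotProduct_sum]
          simp only [dotProduct_smul, hqy, smul_eq_mul, mul_sub, mul_one, Finset.sum_sub_distrib]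
          simp only [mul_sub, mul_one] at hsum
          rw [hsum]
          have := (h.pos i).ne'
          have := hr'.ne'
          simp
          field_simp
          ring
      · rintro ⟨s, hs0, hs1, rfl⟩ z hz
        obtain ⟨t, ht0, ht1, rfl⟩ := mem_simplex_iff.1 hz
        rw [sum_dotProduct, ← ht1]
        refine Finset.sum_le_sum fun i _ => ?_
        rw [smul_dotProduct, smul_eq_mul]
        refine mul_le_of_le_one_right (ht0 i) ?_
        rw [dotProduct_sum, ← hs1]
        refine Finset.sum_le_sum fun j _ => ?_
        rw [dotProduct_smul, smul_eq_mul, hqy]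
        refine mul_le_of_le_one_right (hs0 j) ?_
        have := (div_pos hr' (h.pos j)).le
        split_ifs <;> linarith
    rw [hdual]
    exact isLatticePolytope_simplex _

end Gorenstein

/-! ### Lattice pyramids and integral affine functions -/

section Pyramid

/-- Since `e` pairs to `1` with `y`, the lattice splits as the kernel of `y` plus `ℤ e`. A basis of
the kernel followed by `e` has `y` as its last coordinate function. -/
theorem exists_unimodular_last_column {k : ℕ} {e y : Fin (k + 1) → ℤ} (h : e ⬝ᵥ y = 1) :
    ∃ U : Matrix (Fin (k + 1)) (Fin (k + 1)) ℤ, IsUnit U.det ∧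
      ∀ x, (x ᵥ* U) (Fin.last k) = x ⬝ᵥ y := by
  let f : (Fin (k + 1) → ℤ) →ₗ[ℤ] ℤ :=
    { toFun := fun x => x ⬝ᵥ y
      map_add' := fun a b => add_dotProduct a b y
      map_smul' := fun a b => smul_dotProduct a b y }
  have hfe : f e = 1 := h
  have hsurj : Function.Surjective f := fun a =>
    ⟨a • e, by rw [map_smul, hfe, smul_eq_mul, mul_one]⟩
  have hrank : Module.finrank ℤ (LinearMap.ker f) = k := by
    have h1 := (LinearMap.ker f).finrank_quotient_add_finrank
    rw [(f.quotKerEquivOfSurjective hsurj).finrank_eq, Module.finrank_self,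
      Module.finrank_fin_fun] at h1
    omega
  let b := Module.finBasisOfFinrankEq ℤ (LinearMap.ker f) hrank
  let B := Module.Basis.mkFinSnoc b e
    (fun c x hx hc => by
      have := congrArg f hc
      rw [map_add, map_smul, hfe, LinearMap.mem_ker.1 hx] at this
      simpa using this)
    (fun z => ⟨-f z, by rw [LinearMap.mem_ker, map_add, map_smul, hfe]; simp⟩)
  have hB : ∀ x, B.equivFun x (Fin.last k) = f x := fun x => by
    conv_rhs => rw [← B.sum_equivFun x]
    have hl : B (Fin.last k) = e := by simp [B]
    have hc : ∀ i : Fin k, B i.castSucc = b i := fun i => by simp [B]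
    rw [map_sum, Fin.sum_univ_castSucc, Finset.sum_eq_zero fun i _ => ?_, map_smul, hl, hfe]
    · simp
    · rw [map_smul, hc, LinearMap.mem_ker.1 (b i).2, smul_zero]
  refine ⟨(LinearMap.toMatrix' (B.equivFun : (Fin (k + 1) → ℤ) →ₗ[ℤ] _))ᵀ, ?_, fun x => ?_⟩
  · rw [Matrix.det_transpose, LinearMap.det_toMatrix']
    exact LinearEquiv.isUnit_det' _
  · rw [Matrix.vecMul_transpose, LinearMap.toMatrix'_mulVec]
    exact hB x

/-- The embedding `x ↦ (x, 0)`. -/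
def snocZero (k : ℕ) : (Fin k → ℝ) →ₗ[ℝ] (Fin (k + 1) → ℝ) where
  toFun x := Fin.snoc x 0
  map_add' x y := by
    ext i
    refine Fin.lastCases ?_ (fun i => ?_) i <;> simp
  map_smul' a x := by
    ext i
    refine Fin.lastCases ?_ (fun i => ?_) i <;> simp

theorem pyramid_simplex {n k : ℕ} (v : Fin n → Fin k → ℤ) :
    pyramid (simplex v) = convexHull ℝ
      (Set.range (fun i => snocZero k (toReal (v i))) ∪ {Fin.snoc (0 : Fin k → ℝ) 1}) := by
  have h : (fun x : Fin k → ℝ => (Fin.snoc x 0 : Fin (k + 1) → ℝ)) '' simplex v =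
      convexHull ℝ (Set.range (fun i => snocZero k (toReal (v i)))) := by
    change snocZero k '' convexHull ℝ _ = _
    rw [LinearMap.image_convexHull, ← Set.range_comp]
    rfl
  rw [pyramid, h, convexHull_convexHull_union_left]

/-- Once the affine function is made the last coordinate, vertex `j` lies at height one and the
others at height zero; a translation puts `j` at the standard apex. -/
theorem isLatticePyramid_of_affine {k : ℕ} {v : Fin (k + 2) → Fin (k + 1) → ℤ}
    (hv : IsSimplexVertices v) {j : Fin (k + 2)} {y : Fin (k + 1) → ℤ} {c : ℤ}
    (hy : ∀ i, v i ⬝ᵥ y + c = if i = j then 1 else 0) : IsLatticePyramid (simplex v) := by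
  obtain ⟨U, hU, hlast⟩ : ∃ U : Matrix (Fin (k + 1)) (Fin (k + 1)) ℤ, IsUnit U.det ∧
      ∀ x, (x ᵥ* U) (Fin.last k) = x ⬝ᵥ y := by
    obtain ⟨l, hl⟩ := exists_ne j
    refine exists_unimodular_last_column (e := v j - v l) ?_
    have h1 := hy j
    have h2 := hy l
    rw [if_pos rfl] at h1
    rw [if_neg hl] at h2
    rw [sub_dotProduct]
    linear_combination h1 - h2
  set w : Fin (k + 1) → ℤ := Fin.snoc 0 1 - v j ᵥ* U with hw
  set q : Fin (k + 2) → Fin (k + 1) → ℤ := fun i => ((1 : ℕ) : ℤ) • (v i ᵥ* U) + w with hq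
  have hqv : IsSimplexVertices q := hv.unimodular_image one_pos hU w
  have hqj : toReal (q j) = Fin.snoc (0 : Fin k → ℝ) 1 := by
    ext i
    refine Fin.lastCases ?_ (fun i => ?_) i <;> simp [hq, hw, toReal]
  have hql : ∀ i, i ≠ j → q i (Fin.last k) = 0 := by
    intro i hi
    have h1 := hy j
    have h2 := hy i
    rw [if_pos rfl] at h1
    rw [if_neg hi] at h2
    simp only [hq, hw, Nat.cast_one, one_smul, Pi.add_apply, Pi.sub_apply, hlast, Fin.snoc_last]
    linear_combination h2 - h1
  set u : Fin (k + 1) → Fin k → ℤ := fun i => Fin.init (q (j.succAbove i)) with hu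
  have hsn : ∀ i, snocZero k (toReal (u i)) = toReal (q (j.succAbove i)) := by
    intro i
    ext l
    refine Fin.lastCases ?_ (fun l => ?_) l
    · simp [snocZero, toReal, hql _ (Fin.succAbove_ne j i)]
    · simp [snocZero, toReal, hu, Fin.init]
  have huv : IsSimplexVertices u := by
    refine AffineIndependent.of_comp (snocZero k).toAffineMap ?_
    have := hqv.comp_embedding (Fin.succAboveEmb j)
    refine Eq.mp ?_ this
    congr 1
    ext i : 1
    exact (hsn i).symm
  refine ⟨simplex u, isLatticePolytope_simplex u, ?_, U, w, hU, ?_⟩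
  · unfold IsFullDimensional simplex
    rw [affineSpan_convexHull]
    exact huv.affineSpan_eq_top rfl
  · have h1 := unimodular_image_smul_simplex v 1 U w
    rw [Nat.cast_one, one_smul] at h1
    rw [h1, pyramid_simplex]
    unfold simplex
    congr 1
    change _ = Set.range (fun i => toReal (q i))
    ext x
    simp only [Set.mem_union, Set.mem_range, Set.mem_singleton_iff, hsn, ← hqj]
    symm
    constructor
    · rintro ⟨i, rfl⟩
      by_cases hi : i = j
      · exact Or.inr (by rw [hi])
      · obtain ⟨l, rfl⟩ := Fin.exists_succAbove_eq hi
        exact Or.inl ⟨l, rfl⟩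
    · rintro (⟨i, rfl⟩ | rfl)
      exacts [⟨_, rfl⟩, ⟨j, rfl⟩]

theorem pyramid_subset {k : ℕ} (Q : Set (Fin k → ℝ)) :
    pyramid Q ⊆ {x | 0 ≤ x (Fin.last k) ∧ x (Fin.last k) ≤ 1 ∧
      (x (Fin.last k) = 1 → x = Fin.snoc (0 : Fin k → ℝ) 1)} := by
  refine convexHull_min ?_ ?_
  · rintro _ (⟨x, -, rfl⟩ | rfl) <;> simp
  · rintro x ⟨hx0, hx1, hx⟩ z ⟨hz0, hz1, hz⟩ a b ha hb hab
    simp only [Set.mem_ofPred_eq, Pi.add_apply, Pi.smul_apply, smul_eq_mul]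
    refine ⟨by positivity, by nlinarith, fun h => ?_⟩
    rcases ha.eq_or_lt with rfl | ha
    · obtain rfl : b = 1 := by linarith
      simpa using hz (by simpa using h)
    rcases hb.eq_or_lt with rfl | hb
    · obtain rfl : a = 1 := by linarith
      simpa using hx (by simpa using h)
    rw [hx (by nlinarith), hz (by nlinarith), ← add_smul, hab, one_smul]

/-- The last coordinate on the pyramid lies in `[0, 1]` and is `1` only at the apex. The transformed
vertices are integral, so their heights are `0` or `1`; one must be `1` for the apex to be reached,
and only one by injectivity. -/
theorem IsLatticePyramid.exists_affine {n d : ℕ} {v : Fin n → Fin d → ℤ}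
    (h : IsLatticePyramid (simplex v)) (hv : IsSimplexVertices v) :
    ∃ (j : Fin n) (y : Fin d → ℤ) (c : ℤ), ∀ i, v i ⬝ᵥ y + c = if i = j then 1 else 0 := by
  cases d with
  | zero => exact h.elim
  | succ k =>
    obtain ⟨Q, -, -, U, w, hU, hQ⟩ := h
    have h1 := unimodular_image_smul_simplex v 1 U w
    rw [Nat.cast_one, one_smul, ← hQ] at h1
    set q : Fin n → Fin (k + 1) → ℤ := fun i => ((1 : ℕ) : ℤ) • (v i ᵥ* U) + w with hq
    have hqv : IsSimplexVertices q := hv.unimodular_image one_pos hU w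
    have hmem : ∀ i, toReal (q i) ∈ pyramid Q := fun i => by
      rw [h1]; exact subset_convexHull ℝ _ ⟨i, rfl⟩
    have h0 : ∀ i, 0 ≤ q i (Fin.last k) := fun i => by
      have : (0 : ℝ) ≤ ((q i (Fin.last k) : ℤ) : ℝ) := (pyramid_subset Q (hmem i)).1
      exact_mod_cast this
    have hle : ∀ i, q i (Fin.last k) ≤ 1 := fun i => by
      have : ((q i (Fin.last k) : ℤ) : ℝ) ≤ 1 := (pyramid_subset Q (hmem i)).2.1
      exact_mod_cast this
    have hapex : ∀ i, q i (Fin.last k) = 1 → toReal (q i) = Fin.snoc (0 : Fin k → ℝ) 1 :=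
      fun i hi => (pyramid_subset Q (hmem i)).2.2 (by simp [toReal, hi])
    obtain ⟨j, hj⟩ : ∃ j, q j (Fin.last k) = 1 := by
      by_contra! hne
      have hz : ∀ i, q i (Fin.last k) = 0 := fun i => by
        have := h0 i; have := hle i; have := hne i; omega
      have ha : (Fin.snoc (0 : Fin k → ℝ) 1 : Fin (k + 1) → ℝ) ∈ pyramid Q :=
        subset_convexHull ℝ _ (Or.inr rfl)
      rw [h1, mem_simplex_iff] at ha
      obtain ⟨t, -, -, ht⟩ := ha
      have := congrFun ht (Fin.last k)
      simp [toReal, hz] at this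
    refine ⟨j, fun i => U i (Fin.last k), w (Fin.last k), fun i => ?_⟩
    have hval : v i ⬝ᵥ (fun i => U i (Fin.last k)) + w (Fin.last k) = q i (Fin.last k) := by
      simp [hq, Matrix.vecMul]
    rw [hval]
    split_ifs with hij
    · rw [hij, hj]
    · have : q i (Fin.last k) ≠ 1 := fun hi =>
        hij (hqv.injective ((hapex i hi).trans (hapex j hj).symm))
      have := h0 i; have := hle i; omega

end Pyramid

/-! ### Half-integral group elements and parity codes -/

section Code

theorem hammingNorm_cast_eq_sum {n : ℕ} (c : Fin n → ZMod 2) :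
    (hammingNorm c : ZMod 2) = ∑ i, c i := by
  rw [hammingNorm, Finset.card_filter, Nat.cast_sum]
  refine Finset.sum_congr rfl fun i _ => ?_
  generalize c i = a
  revert a
  decide

theorem isEvenCode_iff {n : ℕ} {C : BinaryCode n} : IsEvenCode C ↔ ∀ c ∈ C, ∑ i, c i = 0 := by
  refine forall₂_congr fun c _ => ?_
  rw [← hammingNorm_cast_eq_sum, ZMod.natCast_eq_zero_iff_even]

theorem val_cast_eq (a : ZMod 2) : ((a.val : ℤ) : ZMod 2) = a := by
  revert a; decide

theorem val_intCast_of_mem {a : ℤ} (h0 : 0 ≤ a) (h1 : a < 2) : (((a : ZMod 2).val : ℤ)) = a := by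
  interval_cases a <;> rfl

theorem sum_half_smul_toReal {n d : ℕ} (m : Fin n → ℤ) (v : Fin n → Fin d → ℤ) :
    ∑ i, ((1 / 2 : ℝ) * (m i : ℝ)) • toReal (v i) = (1 / 2 : ℝ) • toReal (∑ i, m i • v i) := by
  ext k
  simp [toReal, Finset.mul_sum, mul_assoc]

theorem half_mem_associatedGroup_iff {n d : ℕ} {v : Fin n → Fin d → ℤ} {c : Fin n → ZMod 2} :
    (fun i => (1 / 2 : ℝ) * ((c i).val : ℝ)) ∈ associatedGroup v ↔
      (∃ p, ∑ i, ((c i).val : ℤ) • v i = (2 : ℤ) • p) ∧ ∑ i, c i = 0 := by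
  have hI : ∀ i, (1 / 2 : ℝ) * ((c i).val : ℝ) ∈ Set.Ico (0 : ℝ) 1 := fun i => by
    have : (((c i).val : ℕ) : ℝ) < 2 := by exact_mod_cast ZMod.val_lt (c i)
    exact ⟨by positivity, by linarith⟩
  have h1 : (∑ i, ((1 / 2 : ℝ) * ((c i).val : ℝ)) • toReal (v i)) ∈ integerLattice d ↔
      ∃ p, ∑ i, ((c i).val : ℤ) • v i = (2 : ℤ) • p := by
    have := sum_half_smul_toReal (fun i => ((c i).val : ℤ)) v
    simp only [Int.cast_natCast] at this
    rw [this]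
    refine exists_congr fun p => ?_
    rw [← toReal_injective.eq_iff, toReal_smul]
    constructor
    · intro h; rw [h, smul_smul]; norm_num
    · intro h; rw [h, smul_smul]; norm_num
  have h2 : (∃ m : ℤ, ∑ i, (1 / 2 : ℝ) * ((c i).val : ℝ) = m) ↔ ∑ i, c i = 0 := by
    have h3 : ∑ i, c i = ((∑ i, ((c i).val : ℤ) : ℤ) : ZMod 2) := by
      rw [Int.cast_sum]
      exact Finset.sum_congr rfl fun i _ => (val_cast_eq _).symm
    rw [h3, ZMod.intCast_zmod_eq_zero_iff_dvd, ← Finset.mul_sum]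
    refine exists_congr fun m => ?_
    rw [← @Int.cast_inj ℝ]
    push_cast
    constructor <;> intro h <;> linarith
  exact ⟨fun h => ⟨h1.1 h.2.1, h2.1 h.2.2⟩, fun h => ⟨hI, h1.2 h.1, h2.2 h.2⟩⟩

/-- The binary relations between the homogenized vertices modulo `2`. -/
def parityCode {n d : ℕ} (v : Fin n → Fin d → ℤ) : BinaryCode n where
  carrier := {c | (∀ k, ∑ i, c i * (v i k : ZMod 2) = 0) ∧ ∑ i, c i = 0}
  zero_mem' := by simp
  add_mem' := by
    rintro a b ⟨ha, ha'⟩ ⟨hb, hb'⟩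
    simp_all [add_mul, Finset.sum_add_distrib]
  smul_mem' := by
    rintro a b ⟨hb, hb'⟩
    simp_all [mul_assoc, ← Finset.mul_sum]

theorem half_mem_associatedGroup_iff_mem_parityCode {n d : ℕ} {v : Fin n → Fin d → ℤ}
    {c : Fin n → ZMod 2} :
    (fun i => (1 / 2 : ℝ) * ((c i).val : ℝ)) ∈ associatedGroup v ↔ c ∈ parityCode v := by
  rw [half_mem_associatedGroup_iff]
  refine and_congr ?_ Iff.rfl
  have h : ∀ k, ∑ i, c i * (v i k : ZMod 2) =
      (((∑ i, ((c i).val : ℤ) • v i) k : ℤ) : ZMod 2) := fun k => by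
    simp only [Finset.sum_apply, Pi.smul_apply, smul_eq_mul, Int.cast_sum, Int.cast_mul,
      val_cast_eq]
  simp only [h, ZMod.intCast_zmod_eq_zero_iff_dvd]
  constructor
  · rintro ⟨p, hp⟩ k
    rw [hp]
    exact ⟨p k, rfl⟩
  · intro hk
    choose p hp using hk
    exact ⟨p, funext hp⟩

theorem associatedGroup_eq_halfCode_parityCode {n d : ℕ} {v : Fin n → Fin d → ℤ}
    (h : ∀ x ∈ associatedGroup v, ∀ i, ∃ a : ℤ, x i = a * (1 / 2)) :
    associatedGroup v = halfCode (parityCode v) := by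
  ext x
  constructor
  · intro hx
    choose a ha using h x hx
    have hxa : x = fun i => (1 / 2 : ℝ) * (((a i : ZMod 2)).val : ℝ) := by
      ext i
      obtain ⟨h0, h1⟩ := hx.1 i
      rw [ha] at h0 h1
      have h0' : 0 ≤ a i := by
        have : (0 : ℝ) ≤ a i := by linarith
        exact_mod_cast this
      have h1' : a i < 2 := by
        have : (a i : ℝ) < 2 := by linarith
        exact_mod_cast this
      have := congrArg (Int.cast : ℤ → ℝ) (val_intCast_of_mem h0' h1')
      rw [Int.cast_natCast] at this
      rw [this, ha]
      ring
    refine ⟨_, half_mem_associatedGroup_iff_mem_parityCode.1 (hxa ▸ hx), hxa⟩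
  · rintro ⟨c, hc, rfl⟩
    exact half_mem_associatedGroup_iff_mem_parityCode.2 hc

end Code

/-! ### A simplex with a prescribed even code -/

section Realization

variable {d : ℕ}

theorem two_dvd_sum_val {n : ℕ} {c : Fin n → ZMod 2} (h : ∑ i, c i = 0) :
    (2 : ℤ) ∣ ∑ i, ((c i).val : ℤ) := by
  refine (ZMod.intCast_zmod_eq_zero_iff_dvd _ 2).1 ?_
  rw [Int.cast_sum, ← h]
  exact Finset.sum_congr rfl fun i _ => val_cast_eq (c i)

/-- The integer vectors with coordinate sum zero whose reduction modulo `2` lies in `C`. -/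
def zeroSumLattice {n : ℕ} (C : BinaryCode n) : Submodule ℤ (Fin n → ℤ) where
  carrier := {m | (fun i => (m i : ZMod 2)) ∈ C ∧ ∑ i, m i = 0}
  zero_mem' := ⟨by convert C.zero_mem using 1; ext i; simp, by simp⟩
  add_mem' := by
    rintro a b ⟨ha, ha'⟩ ⟨hb, hb'⟩
    refine ⟨?_, by simp [Finset.sum_add_distrib, ha', hb']⟩
    convert C.add_mem ha hb using 1
    ext i; simp
  smul_mem' := by
    rintro a b ⟨hb, hb'⟩
    refine ⟨?_, by simp [← Finset.mul_sum, hb']⟩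
    convert C.smul_mem (a : ZMod 2) hb using 1
    ext i; simp

/-- The lattice lies between the zero-sum vectors and their doubles. -/
theorem finrank_zeroSumLattice (C : BinaryCode (d + 1)) :
    Module.finrank ℤ (zeroSumLattice C) = d := by
  let f : (Fin (d + 1) → ℤ) →ₗ[ℤ] ℤ := ∑ i, LinearMap.proj i
  have hf : ∀ m, f m = ∑ i, m i := fun m => by simp [f]
  have hker : Module.finrank ℤ (LinearMap.ker f) = d := by
    have hsurj : Function.Surjective f := fun a => ⟨Pi.single 0 a, by simp [hf]⟩
    have h1 := (LinearMap.ker f).finrank_quotient_add_finrank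
    rw [(f.quotKerEquivOfSurjective hsurj).finrank_eq, Module.finrank_self,
      Module.finrank_fin_fun] at h1
    omega
  refine le_antisymm ?_ ?_
  · have hle : zeroSumLattice C ≤ LinearMap.ker f := fun m hm =>
      LinearMap.mem_ker.2 ((hf m).trans hm.2)
    exact (Submodule.finrank_mono hle).trans hker.le
  · have h2 : ∀ m : LinearMap.ker f, (2 : ℤ) • (m : Fin (d + 1) → ℤ) ∈ zeroSumLattice C := by
      intro m
      refine ⟨?_, ?_⟩
      · convert C.zero_mem using 1
        ext i
        have : (2 : ZMod 2) = 0 := rfl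
        simp [this]
      · have := (hf m).symm.trans (LinearMap.mem_ker.1 m.2)
        simp [← Finset.mul_sum, this]
    calc d = Module.finrank ℤ (LinearMap.ker f) := hker.symm
      _ ≤ _ := LinearMap.finrank_le_finrank_of_injective
          (f := ((2 : ℤ) • (LinearMap.ker f).subtype).codRestrict (zeroSumLattice C) h2) (by
            intro a b hab
            have := congrArg Subtype.val hab
            exact Subtype.ext (smul_right_injective _ (two_ne_zero (α := ℤ)) this))

/-- Every binary code whose words have even weight is the parity code of a simplex with half-integral
barycentric lattice coordinates. -/
theorem exists_simplex_of_code (C : BinaryCode (d + 1)) (hC : IsEvenCode C) :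
    ∃ v : Fin (d + 1) → Fin d → ℤ, parityCode v = C ∧
      ∀ j, ∃ (y : Fin d → ℤ) (c : ℤ), ∀ i, v i ⬝ᵥ y + c = if i = j then 2 else 0 := by
  let b := Module.finBasisOfFinrankEq ℤ (zeroSumLattice C) (finrank_zeroSumLattice C)
  have two : (2 : ZMod 2) = 0 := rfl
  -- An even correction in coordinate `0` makes the sum zero without changing the reduction.
  have hmem : ∀ (m : Fin (d + 1) → ℤ) (a : ℤ), (fun i => (m i : ZMod 2)) ∈ C →
      ∑ i, m i = 2 * a → m - Pi.single 0 (2 * a) ∈ zeroSumLattice C := by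
    intro m a hm ha
    refine ⟨?_, by simp [Finset.sum_sub_distrib, ha]⟩
    convert hm using 1
    ext i
    by_cases hi : i = 0
    · subst hi; simp [two]
    · simp [hi]
  have hu : ∀ i, (Pi.single i 2 - Pi.single 0 (2 * 1) : Fin (d + 1) → ℤ) ∈ zeroSumLattice C := by
    intro i
    refine hmem _ _ ?_ (by simp)
    convert C.zero_mem using 1
    ext l
    by_cases hl : l = i
    · subst hl; simp [two]
    · simp [hl]
  set v : Fin (d + 1) → Fin d → ℤ := fun i => b.equivFun ⟨_, hu i⟩ with hv
  have hdot : ∀ (x : zeroSumLattice C) j,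
      b.equivFun x ⬝ᵥ (fun k => (b k : Fin (d + 1) → ℤ) j) = (x : Fin (d + 1) → ℤ) j := by
    intro x j
    conv_rhs => rw [← b.sum_equivFun x]
    rw [Submodule.coe_sum, Finset.sum_apply]
    rfl
  -- The vertex `v i` represents `2 e_i - 2 e_0`; the constant at `j = 0` undoes the shift by `2
  -- e_0`.
  have hfun : ∀ i j, v i ⬝ᵥ (fun k => (b k : Fin (d + 1) → ℤ) j) +
      (if j = 0 then 2 else 0) = if i = j then 2 else 0 := by
    intro i j
    rw [hv]
    dsimp only
    rw [hdot]
    simp [Pi.single_apply, eq_comm (a := i)]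
  refine ⟨v, ?_, fun j => ⟨_, _, fun i => hfun i j⟩⟩
  ext c
  rw [← half_mem_associatedGroup_iff_mem_parityCode, half_mem_associatedGroup_iff]
  constructor
  · rintro ⟨⟨p, hp⟩, hsum⟩
    obtain ⟨a, ha⟩ := two_dvd_sum_val hsum
    -- Pairing `∑ c_i v_i = 2 p` with the coordinate functions shows that `c` is congruent modulo
    -- `2` to the lattice vector with coordinates `p`.
    have hval : ∀ j, ((c j).val : ℤ) =
        ((b.equivFun.symm p : zeroSumLattice C) : Fin (d + 1) → ℤ) j +
          if j = 0 then 2 * a else 0 := by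
      intro j
      have h1 : ∑ i, ((c i).val : ℤ) * (v i ⬝ᵥ (fun k => (b k : Fin (d + 1) → ℤ) j) +
          (if j = 0 then 2 else 0)) = 2 * ((c j).val : ℤ) := by
        simp [hfun, mul_comm]
      simp only [mul_add, Finset.sum_add_distrib, ← Finset.sum_mul, ha] at h1
      have h2 := congrArg (· ⬝ᵥ fun k => (b k : Fin (d + 1) → ℤ) j) hp
      simp only [sum_dotProduct, smul_dotProduct, smul_eq_mul] at h2
      have h3 := hdot (b.equivFun.symm p) j
      rw [LinearEquiv.apply_symm_apply] at h3
      rw [h2, h3] at h1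
      split_ifs at h1 ⊢ <;> linarith
    have h4 := (b.equivFun.symm p).2.1
    convert h4 using 1
    ext j
    rw [← val_cast_eq (c j), hval]
    split_ifs <;> simp [two]
  · intro hc
    have hsum := isEvenCode_iff.1 hC c hc
    refine ⟨?_, hsum⟩
    obtain ⟨a, ha⟩ := two_dvd_sum_val hsum
    have hm := hmem (fun i => ((c i).val : ℤ)) a (by simpa only [val_cast_eq] using hc) ha
    -- Here `∑ c_i (2 e_i - 2 e_0) = 2 (c - 2a e_0)`, because the entries of `c` sum to `2a`.
    refine ⟨b.equivFun ⟨_, hm⟩, ?_⟩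
    simp only [hv]
    simp only [← map_smul, ← map_sum]
    congr 1
    apply Subtype.ext
    ext j
    simp only [Submodule.coe_sum, Submodule.coe_smul, Finset.sum_apply, Pi.smul_apply,
      Pi.sub_apply, smul_eq_mul, mul_sub, Finset.sum_sub_distrib, ← Finset.sum_mul, ha]
    simp only [Pi.single_apply, mul_ite, mul_zero, Finset.sum_ite_eq, Finset.mem_univ, if_true]
    split_ifs <;> ring

end Realization

/-! ### Weights one half and the two directions -/

section Main

variable {n d s : ℕ} {v : Fin n → Fin d → ℤ}

theorem isSelfComplementary_parityCode (h : IsGorensteinWeight v s fun _ => 1 / 2) :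
    IsSelfComplementary (parityCode v) := by
  obtain ⟨w, hw⟩ := h.lattice
  rw [IsSelfComplementary, ← half_mem_associatedGroup_iff_mem_parityCode]
  have h1 : ((1 : ZMod 2).val : ℝ) = 1 := by norm_num [ZMod.val_one]
  simp only [h1, mul_one]
  exact ⟨fun i => by constructor <;> norm_num, ⟨w, hw.symm⟩, s, by simpa using h.sum_eq⟩

theorem associatedGroup_eq_of_weight_half (h : IsGorensteinWeight v s fun _ => 1 / 2) :
    associatedGroup v = halfCode (parityCode v) := by
  refine associatedGroup_eq_halfCode_parityCode ?_
  rintro x ⟨-, ⟨p, hp⟩, m, hm⟩ i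
  exact h.exists_int hp.symm hm i

/-- An integral affine function that is `1` at one vertex and `0` at the others would take the value
`1/2` at the lattice point of weight `1/2`. -/
theorem not_isLatticePyramid_of_weight_half (h : IsGorensteinWeight v s fun _ => 1 / 2) :
    ¬ IsLatticePyramid (simplex v) := by
  intro hpyr
  obtain ⟨j, y, c, hy⟩ := hpyr.exists_affine h.isSimplexVertices
  obtain ⟨w, hw⟩ := h.lattice
  have h1 := sum_mul_affine_eq_intCast (m := s) hw (by exact_mod_cast h.sum_eq) y c
  have h2 : ∀ i, toReal (v i) ⬝ᵥ toReal y + c = if i = j then 1 else 0 := fun i => by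
    rw [toReal_dotProduct]
    exact_mod_cast congrArg (Int.cast : ℤ → ℝ) (hy i)
  simp only [h2, mul_ite, mul_one, mul_zero, Finset.sum_ite_eq', Finset.mem_univ, if_true] at h1
  have h3 : (1 : ℝ) = ((2 * (w ⬝ᵥ y + s * c) : ℤ) : ℝ) := by
    rw [Int.cast_mul, ← h1]; norm_num
  have h4 : (1 : ℤ) = 2 * (w ⬝ᵥ y + s * c) := by exact_mod_cast h3
  omega

theorem IsGorensteinWeight.eq_half {α : Fin n → ℝ} (h : IsGorensteinWeight v s α)
    (hn : n = d + 1) (hs : n = 2 * s) (hpyr : ¬ IsLatticePyramid (simplex v)) :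
    α = fun _ => 1 / 2 := by
  have hv := h.isSimplexVertices
  have hle : ∀ j, α j ≤ 1 / 2 := by
    intro j
    obtain ⟨y, c, hy⟩ := h.integral j
    have hint : 1 / α j = ((v j ⬝ᵥ y + c : ℤ) : ℝ) := by
      rw [Int.cast_add, ← toReal_dotProduct, hy, if_pos rfl]
    have hpos : 0 < v j ⬝ᵥ y + c := by
      have := one_div_pos.2 (h.pos j)
      rw [hint] at this
      exact_mod_cast this
    have hne : v j ⬝ᵥ y + c ≠ 1 := by
      intro h1
      refine hpyr ?_
      have hy' : ∀ i, v i ⬝ᵥ y + c = if i = j then 1 else 0 := fun i => by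
        split_ifs with hij
        · rw [hij, h1]
        · have := hy i
          rw [if_neg hij, toReal_dotProduct] at this
          exact_mod_cast this
      subst hn
      -- Dimension zero is excluded because the number of vertices is even.
      obtain ⟨k, rfl⟩ : ∃ k, d = k + 1 := ⟨d - 1, by omega⟩
      exact isLatticePyramid_of_affine hv hy'
    have h2 : (2 : ℝ) ≤ 1 / α j := by
      rw [hint]
      have : 2 ≤ v j ⬝ᵥ y + c := by omega
      exact_mod_cast this
    rw [le_div_iff₀ (h.pos j)] at h2
    linarith
  have hsum : ∑ i, α i = ∑ _i : Fin n, (1 / 2 : ℝ) := by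
    rw [h.sum_eq, Finset.sum_const, Finset.card_univ, Fintype.card_fin, hs, nsmul_eq_mul]
    push_cast
    ring
  ext j
  exact (Finset.sum_eq_sum_iff_of_le fun i _ => hle i).1 hsum j (Finset.mem_univ j)

theorem exists_code_of_gorenstein (hn : n = d + 1) (hs : n = 2 * s) (hv : IsSimplexVertices v)
    (hG : IsGorenstein (simplex v)) (hdeg : degree (simplex v) = s)
    (hpyr : ¬ IsLatticePyramid (simplex v)) :
    ∃ C : BinaryCode n, IsEvenCode C ∧ IsSelfComplementary C ∧
      associatedGroup v = halfCode C := by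
  obtain ⟨r, hr⟩ := hG
  obtain ⟨α, hα⟩ := hr.exists_weight hv hn (by omega)
  obtain rfl : r = s := by
    rw [degree, hα.codegree_eq hn] at hdeg
    omega
  obtain rfl := hα.eq_half hn hs hpyr
  exact ⟨parityCode v, isEvenCode_iff.2 fun c hc => hc.2, isSelfComplementary_parityCode hα,
    associatedGroup_eq_of_weight_half hα⟩

theorem exists_gorenstein_of_code (hn : n = d + 1) (hs : n = 2 * s) (C : BinaryCode n)
    (hC : IsEvenCode C) (hC1 : IsSelfComplementary C) :
    ∃ v : Fin n → Fin d → ℤ, IsSimplexVertices v ∧ IsGorenstein (simplex v) ∧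
      degree (simplex v) = s ∧ ¬ IsLatticePyramid (simplex v) ∧
      associatedGroup v = halfCode C := by
  subst hn
  obtain ⟨v, rfl, hy⟩ := exists_simplex_of_code C hC
  have hw : IsGorensteinWeight v s fun _ => 1 / 2 := by
    refine ⟨fun _ => by norm_num, ?_, ?_, fun j => ?_⟩
    · rw [Finset.sum_const, Finset.card_univ, Fintype.card_fin, hs, nsmul_eq_mul]
      push_cast
      ring
    · obtain ⟨-, ⟨w, hw⟩, -⟩ := half_mem_associatedGroup_iff_mem_parityCode.2 hC1
      have h1 : ((1 : ZMod 2).val : ℝ) = 1 := by norm_num [ZMod.val_one]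
      simp only [h1, mul_one] at hw
      exact ⟨w, hw.symm⟩
    · obtain ⟨y, c, h⟩ := hy j
      refine ⟨y, c, fun i => ?_⟩
      rw [toReal_dotProduct, one_div_one_div]
      exact_mod_cast congrArg (Int.cast : ℤ → ℝ) (h i)
  refine ⟨v, hw.isSimplexVertices, hw.isGorenstein rfl, ?_,
    not_isLatticePyramid_of_weight_half hw, associatedGroup_eq_of_weight_half hw⟩
  rw [degree, hw.codegree_eq rfl]
  omega

end Main

end LatticeSimplexCode

theorem theorem1p1 (s : ℕ) (hs : 1 ≤ s) :
    (∀ v : Fin (2 * s) → Fin (2 * s - 1) → ℤ,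
      IsSimplexVertices v →
      IsGorenstein (simplex v) →
      degree (simplex v) = (s : ℤ) →
      ¬ IsLatticePyramid (simplex v) →
      ∃ C : BinaryCode (2 * s), IsEvenCode C ∧ IsSelfComplementary C ∧
        associatedGroup v = halfCode C) ∧
    (∀ C : BinaryCode (2 * s), IsEvenCode C → IsSelfComplementary C →
      ∃ v : Fin (2 * s) → Fin (2 * s - 1) → ℤ,
        IsSimplexVertices v ∧
        IsGorenstein (simplex v) ∧
        degree (simplex v) = (s : ℤ) ∧
        ¬ IsLatticePyramid (simplex v) ∧
        associatedGroup v = halfCode C) := by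
  have hn : 2 * s = 2 * s - 1 + 1 := by omega
  exact ⟨fun v hv hG hdeg hpyr => exists_code_of_gorenstein hn rfl hv hG hdeg hpyr,
    fun C hC hC1 => exists_gorenstein_of_code hn rfl C hC hC1⟩
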